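/- Let $X\neq\{0\}$ be a real Banach space with dual $X^*$ (the space of continuous linear functionals on $X$, with the dual norm). Let $\operatorname{conv}(X)$ be the set of all lower semicontinuous convex functions $f:X\to\mathbb R\cup\{+\infty\}$ that are proper (i.e. not identically $+\infty$), ordered pointwise. Call $T:\operatorname{conv}(X)\to\operatorname{conv}(X)$ *fully order reversing* if it is a bijection and, for all $f,g\in\operatorname{conv}(X)$, $f\ge g$ if and only if $Tf\le Tg$. For $f\in\operatorname{conv}(X)$ let $\mathcal F f$ be its Fenchel transform, $$(\mathcal F f)(x^*)=\sup\{\langle x^*,x\rangle-f(x):x\in X\},\qquad x^*\in X^*.$$ **Theorem.** For every fully order reversing map $T:\operatorname{conv}(X)\to\operatorname{conv}(X)$ there exist a linear isomorphism (a linear homeomorphism onto) $U:X\to X^*$, functionals $x_0^*,\varphi\in X^*$, and real numbers $\alpha>0$ and $r_0$ such that $$(Tf)(x)=\alpha\,(\mathcal F f)(Ux+x_0^*)+\langle\varphi,x\rangle+r_0\qquad\text{for all } f\in\operatorname{conv}(X),\ x\in X.$$ -/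

import Mathlib

/-- An extended-real-valued function `f` is convex:
`f (a x + b y) ≤ a f(x) + b f(y)` for `a, b > 0` with `a + b = 1`. It is only used for functions that
never take the value `-∞`, so that the right-hand side is never of the form `∞ - ∞`. -/
def IsConvexEReal {X : Type*} [AddCommGroup X] [Module ℝ X] (f : X → EReal) : Prop :=
  ∀ x y : X, ∀ a b : ℝ, 0 < a → 0 < b → a + b = 1 →
    f (a • x + b • y) ≤ (a : EReal) * f x + (b : EReal) * f y

/-- `conv(X)`: the extended-real-valued functions on `X` that are proper (nowhere `-∞`, and finite at
some point), convex and lower semicontinuous. As a subtype of `X → EReal` it carries the pointwise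
order. -/
def convCone (X : Type*) [NormedAddCommGroup X] [NormedSpace ℝ X] : Set (X → EReal) :=
  {f | (∀ x, f x ≠ ⊥) ∧ (∃ x, f x ≠ ⊤) ∧ IsConvexEReal f ∧ LowerSemicontinuous f}

/-- The Fenchel transform `(𝓕f)(x*) = sup {⟨x*, x⟩ - f(x) : x ∈ X}`, for `x*` in the dual of `X`. -/
noncomputable def fenchelTransform {X : Type*} [NormedAddCommGroup X] [NormedSpace ℝ X]
    (f : X → EReal) : StrongDual ℝ X → EReal :=
  fun xs => ⨆ x : X, ((xs x : ℝ) : EReal) - f x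

/-- A self-map `T` of a partially ordered set is fully order reversing if it is a bijection and
`f ≥ g ↔ T f ≤ T g`. -/
def IsFullyOrderReversing {P : Type*} [PartialOrder P] (T : P → P) : Prop :=
  Function.Bijective T ∧ ∀ f g : P, f ≥ g ↔ T f ≤ T g

/-!
The affine functions `affineFn ξ c` and the point functions `pointFn x c` (equal to `c` at `x` and
to `+∞` elsewhere) are singled out by the order of `convCone X`: `f` is affine iff the functions
below `f` form a chain, and a point function iff the functions above `f` do. The first equivalence
uses Hahn–Banach, through `exists_affineFn_gt`. An order reversing `T` therefore exchanges the two
families, and comparability inside each family shows that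
`T (pointFn x c) = affineFn (p x) (β x c)` and `T (affineFn ξ c) = pointFn (y ξ) (γ ξ c)`,
with `p : X → X*` and `y : X* → X` onto and each `β x` a decreasing bijection of `ℝ`.

Since `affineFn ξ c ≤ pointFn x d` means `ξ x + c ≤ d`, applying `T` yields the functional equation
`γ ξ c = p x (y ξ) + β x (ξ x + c)`. Comparing it with its instances at `x = 0` and `ξ = 0` gives
`β 0 c - β 0 (c + ξ x) = (p x - p 0) (y ξ - y 0)`. As `ξ x` takes all real values, the monotone
function `β 0` is affine, with some slope `-α < 0`, so the right-hand side is `α * ξ x`. Such a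
pairing between two surjections forces `ξ ↦ y ξ - y 0` to be linear, and the closed graph theorem
makes its inverse `U` a linear homeomorphism of `X` onto its dual. No case distinction on the
dimension and no fundamental theorem of affine geometry is needed.

Finally `T f v ≤ e` means `T f ≤ pointFn v e`, i.e. that `f` is above the affine function which `T`
sends to `pointFn v e`; this is an upper bound for the Fenchel transform of `f` at the slope
`U v - U (y 0)`, which is the asserted formula (`affineFn_le_iff_fenchelTransform_le`).
-/

open Filter Topology

theorem EReal.le_iff_forall_real {a b : EReal} :
    a ≤ b ↔ ∀ r : ℝ, b ≤ r → a ≤ r :=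
  ⟨fun h _ hr => h.trans hr, fun h => EReal.le_of_forall_lt_iff_le.1 fun r hr => h r hr.le⟩

section

variable {X : Type*} [NormedAddCommGroup X] [NormedSpace ℝ X]

/-! ### Affine functions and point functions -/

/-- The continuous affine function `y ↦ ξ y + c`. -/
def affineFn (ξ : StrongDual ℝ X) (c : ℝ) : convCone X :=
  ⟨fun y => ((ξ y + c : ℝ) : EReal), fun _ => EReal.coe_ne_bot _, ⟨0, EReal.coe_ne_top _⟩, by
    intro x y a b _ _ hab
    rw [← EReal.coe_mul, ← EReal.coe_mul, ← EReal.coe_add, EReal.coe_le_coe_iff]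
    simp only [map_add, map_smul, smul_eq_mul]
    apply le_of_eq
    linear_combination (-c) * hab,
    (continuous_coe_real_ereal.comp (by fun_prop)).lowerSemicontinuous⟩

open Classical in
/-- The function with value `c` at `x` and `+∞` elsewhere. -/
noncomputable def pointFn (x : X) (c : ℝ) : convCone X :=
  ⟨fun y => if y = x then (c : EReal) else ⊤, by
    intro y; dsimp only; split_ifs <;> simp, ⟨x, by simp⟩, by
    intro y z a b ha hb hab
    have key : ∀ (t : ℝ), 0 < t → ∀ y : X, (t : EReal) * (if y = x then (c : EReal) else ⊤) ≠ ⊥ := by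
      intro t ht y
      split_ifs
      · rw [← EReal.coe_mul]; exact EReal.coe_ne_bot _
      · rw [EReal.coe_mul_top_of_pos ht]; simp
    by_cases hy : y = x
    · by_cases hz : z = x
      · subst hy; subst hz
        rw [← add_smul, hab, one_smul]
        simp only [if_true]
        norm_cast
        apply le_of_eq
        linear_combination (-c) * hab
      · have := key a ha y
        dsimp only
        rw [if_neg hz, EReal.coe_mul_top_of_pos hb, EReal.add_top_of_ne_bot this]
        exact le_top
    · have := key b hb z
      dsimp only
      rw [if_neg hy, EReal.coe_mul_top_of_pos ha, EReal.top_add_of_ne_bot this]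
      exact le_top, by
    refine lowerSemicontinuous_iff_isClosed_preimage.2 fun t => ?_
    by_cases ht : t = ⊤
    · simp [ht]
    by_cases hc : (c : EReal) ≤ t
    · convert! isClosed_singleton (x := x)
      ext y
      by_cases hy : y = x <;> simp [hy, hc, ht]
    · convert! isClosed_empty (X := X)
      ext y
      by_cases hy : y = x <;> simp [hy, hc, ht]⟩

theorem affineFn_apply (ξ : StrongDual ℝ X) (c : ℝ) (y : X) :
    (affineFn ξ c : X → EReal) y = ((ξ y + c : ℝ) : EReal) := rfl

theorem pointFn_apply_self (x : X) (c : ℝ) : (pointFn x c : X → EReal) x = c := by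
  simp [pointFn]

theorem pointFn_apply_of_ne {x y : X} (h : y ≠ x) (c : ℝ) : (pointFn x c : X → EReal) y = ⊤ := by
  simp [pointFn, h]

theorem le_pointFn_iff {f : convCone X} {x : X} {c : ℝ} :
    f ≤ pointFn x c ↔ (f : X → EReal) x ≤ c := by
  refine ⟨fun h => (h x).trans_eq (pointFn_apply_self x c), fun h y => ?_⟩
  by_cases hy : y = x
  · subst hy; rwa [pointFn_apply_self]
  · rw [pointFn_apply_of_ne hy]; exact le_top

theorem affineFn_le_iff {f : convCone X} {ξ : StrongDual ℝ X} {c : ℝ} :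
    affineFn ξ c ≤ f ↔ ∀ (y : X) (r : ℝ), (f : X → EReal) y ≤ r → ξ y + c ≤ r := by
  refine forall_congr' fun y => ?_
  rw [affineFn_apply, EReal.le_iff_forall_real]
  simp only [EReal.coe_le_coe_iff]

theorem affineFn_le_pointFn_iff {ξ : StrongDual ℝ X} {x : X} {c d : ℝ} :
    affineFn ξ c ≤ pointFn x d ↔ ξ x + c ≤ d := by
  rw [le_pointFn_iff, affineFn_apply, EReal.coe_le_coe_iff]

theorem pointFn_le_pointFn_iff {x y : X} {c d : ℝ} :
    pointFn x c ≤ pointFn y d ↔ x = y ∧ c ≤ d := by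
  rw [le_pointFn_iff]
  constructor
  · intro h
    by_cases hy : y = x
    · subst hy; rw [pointFn_apply_self] at h; exact ⟨rfl, by exact_mod_cast h⟩
    · rw [pointFn_apply_of_ne hy] at h; simp at h
  · rintro ⟨rfl, h⟩
    rw [pointFn_apply_self]; exact_mod_cast h

theorem affineFn_le_affineFn_iff {ξ η : StrongDual ℝ X} {c d : ℝ} :
    affineFn ξ c ≤ affineFn η d ↔ ξ = η ∧ c ≤ d := by
  constructor
  · intro h
    have h' : ∀ y, ξ y + c ≤ η y + d := fun y => by
      have := h y
      rwa [affineFn_apply, affineFn_apply, EReal.coe_le_coe_iff] at this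
    refine ⟨?_, by simpa using h' 0⟩
    ext y
    by_contra hne
    have hne' : ξ y - η y ≠ 0 := sub_ne_zero.2 hne
    have := h' (((d - c + 1) / (ξ y - η y)) • y)
    simp only [map_smul, smul_eq_mul] at this
    have e : (d - c + 1) / (ξ y - η y) * (ξ y - η y) = d - c + 1 := div_mul_cancel₀ _ hne'
    rw [mul_sub] at e
    linarith
  · rintro ⟨rfl, h⟩ y
    rw [affineFn_apply, affineFn_apply, EReal.coe_le_coe_iff]
    linarith

theorem pointFn_inj {x y : X} {c d : ℝ} (h : pointFn x c = pointFn y d) : x = y ∧ c = d :=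
  ⟨(pointFn_le_pointFn_iff.1 h.le).1,
    le_antisymm (pointFn_le_pointFn_iff.1 h.le).2 (pointFn_le_pointFn_iff.1 h.ge).2⟩

theorem affineFn_inj {ξ η : StrongDual ℝ X} {c d : ℝ} (h : affineFn ξ c = affineFn η d) :
    ξ = η ∧ c = d :=
  ⟨(affineFn_le_affineFn_iff.1 h.le).1,
    le_antisymm (affineFn_le_affineFn_iff.1 h.le).2 (affineFn_le_affineFn_iff.1 h.ge).2⟩

theorem affineFn_le_iff_fenchelTransform_le {f : convCone X} {ξ : StrongDual ℝ X} {c : ℝ} :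
    affineFn ξ c ≤ f ↔ fenchelTransform (f : X → EReal) ξ ≤ ((-c : ℝ) : EReal) := by
  rw [fenchelTransform, iSup_le_iff]
  refine forall_congr' fun y => ?_
  rw [affineFn_apply, EReal.sub_le_iff_le_add (Or.inr (EReal.coe_ne_top _))
    (Or.inr (EReal.coe_ne_bot _))]
  induction (f : X → EReal) y with
  | bot => simp
  | top => simp
  | coe r =>
    rw [← EReal.coe_add, EReal.coe_le_coe_iff, EReal.coe_le_coe_iff]
    constructor <;> intro h <;> linarith

/-! ### Convexity along lines and Hahn–Banach separation -/

/-- A convex function below an affine function `h` differs from `h` by a constant, because a convex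
function on a line that is bounded above is constant. -/
theorem exists_eq_affineFn_of_le {g : convCone X} {ξ : StrongDual ℝ X} {c : ℝ}
    (h : g ≤ affineFn ξ c) : ∃ d, g = affineFn ξ d := by
  obtain ⟨g, hbot, hfin, hconv, hlsc⟩ := g
  have hg : ∀ x, ∃ r : ℝ, g x = ((ξ x + r : ℝ) : EReal) ∧ r ≤ c := by
    intro x
    have hx : g x ≤ ((ξ x + c : ℝ) : EReal) := h x
    have hb := hbot x
    revert hx hb
    induction g x with
    | bot => simp
    | top => exact fun hx _ => absurd (top_le_iff.1 hx) (EReal.coe_ne_top _)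
    | coe r =>
      intro hx _
      refine ⟨r - ξ x, by simp, ?_⟩
      rw [EReal.coe_le_coe_iff] at hx
      linarith
  choose G hG hGc using hg
  have hconvG : ∀ x y : X, ∀ a b : ℝ, 0 < a → 0 < b → a + b = 1 →
      G (a • x + b • y) ≤ a * G x + b * G y := by
    intro x y a b ha hb hab
    have := hconv x y a b ha hb hab
    rw [hG, hG, hG] at this
    norm_cast at this
    simp only [map_add, map_smul, smul_eq_mul] at this
    linarith
  have hle : ∀ x y, G y ≤ G x := by
    intro x y
    -- `y = (1 - b) • x + b • z` with `z` beyond `y` on the ray from `x`; then let `b → 0`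
    have key : ∀ b : ℝ, 0 < b → b < 1 → G y ≤ (1 - b) * G x + b * c := by
      intro b hb hb1
      have e : (1 - b) • x + b • (x + b⁻¹ • (y - x)) = y := by
        rw [smul_add, smul_smul, mul_inv_cancel₀ hb.ne', sub_smul, one_smul, one_smul]
        abel
      have := hconvG x (x + b⁻¹ • (y - x)) (1 - b) b (by linarith) hb (by ring)
      rw [e] at this
      nlinarith [hGc (x + b⁻¹ • (y - x))]
    have ht : Tendsto (fun b : ℝ => (1 - b) * G x + b * c) (𝓝[>] 0) (𝓝 (G x)) := by
      have : Continuous fun b : ℝ => (1 - b) * G x + b * c := by fun_prop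
      simpa using (this.tendsto 0).mono_left nhdsWithin_le_nhds
    refine ge_of_tendsto ht ?_
    filter_upwards [Ioo_mem_nhdsGT (zero_lt_one' ℝ)] with b hb using key b hb.1 hb.2
  refine ⟨G 0, Subtype.ext (funext fun x => ?_)⟩
  rw [affineFn_apply]
  change g x = _
  rw [hG, le_antisymm (hle 0 x) (hle x 0)]

/-- Strict separation of a point below the graph from the epigraph. -/
theorem exists_separation (f : convCone X) {x : X} {t : ℝ} (h : (t : EReal) < (f : X → EReal) x) :
    ∃ (η : StrongDual ℝ X) (s u : ℝ), η x + s * t < u ∧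
      ∀ (y : X) (r : ℝ), (f : X → EReal) y ≤ r → u < η y + s * r := by
  obtain ⟨f, hbot, hfin, hconv, hlsc⟩ := f
  change (t : EReal) < f x at h
  have hclosed : IsClosed {p : X × ℝ | f p.1 ≤ (p.2 : EReal)} :=
    hlsc.isClosed_epigraph.preimage
      (continuous_fst.prodMk (continuous_coe_real_ereal.comp continuous_snd))
  have hconvex : Convex ℝ {p : X × ℝ | f p.1 ≤ (p.2 : EReal)} := by
    refine convex_iff_forall_pos.2 ?_
    rintro ⟨y, r⟩ hy ⟨z, r'⟩ hz a b ha hb hab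
    refine (hconv y z a b ha hb hab).trans ?_
    change a * f y + b * f z ≤ ((a * r + b * r' : ℝ) : EReal)
    rw [EReal.coe_add, EReal.coe_mul, EReal.coe_mul]
    have ha' : (0 : EReal) ≤ a := by exact_mod_cast ha.le
    have hb' : (0 : EReal) ≤ b := by exact_mod_cast hb.le
    exact add_le_add (mul_le_mul_of_nonneg_left hy ha') (mul_le_mul_of_nonneg_left hz hb')
  obtain ⟨Φ, u, hx, hu⟩ := geometric_hahn_banach_point_closed (x := (x, t)) hconvex hclosed
    (by simpa using h)
  have hΦ : ∀ (y : X) (r : ℝ), Φ (y, r) = Φ.comp (.inl ℝ X ℝ) y + Φ (0, 1) * r := by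
    intro y r
    have : ((y, r) : X × ℝ) = (y, 0) + r • (0, 1) := by simp
    rw [this, map_add, map_smul, smul_eq_mul, mul_comm]
    simp
  refine ⟨Φ.comp (.inl ℝ X ℝ), Φ (0, 1), u, ?_, fun y r hy => ?_⟩
  · rw [← hΦ]; exact hx
  · rw [← hΦ]; exact hu _ hy

/-- Dividing a non-vertical separating hyperplane by its last coefficient. -/
theorem exists_affineFn_le_of_separation {f : convCone X} {x : X} {t : ℝ} {η : StrongDual ℝ X}
    {s u : ℝ} (hs : 0 < s) (hx : η x + s * t < u)
    (hu : ∀ (y : X) (r : ℝ), (f : X → EReal) y ≤ r → u < η y + s * r) :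
    ∃ (ξ : StrongDual ℝ X) (c : ℝ), affineFn ξ c ≤ f ∧ t < ξ x + c := by
  have e : ∀ y, ((-s⁻¹) • η) y + u / s = (u - η y) / s := fun y => by
    simp only [smul_apply, smul_eq_mul]; ring
  refine ⟨(-s⁻¹) • η, u / s, affineFn_le_iff.2 fun y r hr => ?_, ?_⟩
  · rw [e, div_le_iff₀ hs]
    linarith [hu y r hr]
  · rw [e, lt_div_iff₀ hs]
    linarith

theorem exists_coe_eq (f : convCone X) : ∃ (x : X) (r : ℝ), (f : X → EReal) x = r := by
  obtain ⟨f, hbot, ⟨x, hx⟩, -⟩ := f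
  exact ⟨x, (f x).toReal, (EReal.coe_toReal hx (hbot x)).symm⟩

theorem exists_affineFn_le (f : convCone X) : ∃ (ξ : StrongDual ℝ X) (c : ℝ), affineFn ξ c ≤ f := by
  obtain ⟨x, r, hr⟩ := exists_coe_eq f
  have h : ((r - 1 : ℝ) : EReal) < (f : X → EReal) x := by
    rw [hr, EReal.coe_lt_coe_iff]; linarith
  obtain ⟨η, s, u, hx, hu⟩ := exists_separation f h
  have hs : 0 < s := by linarith [hu x r hr.le]
  obtain ⟨ξ, c, h, -⟩ := exists_affineFn_le_of_separation hs hx hu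
  exact ⟨ξ, c, h⟩

/-- An affine minorant that is not exact at `x` can be replaced by one with a larger value at `x`. -/
theorem exists_affineFn_gt {f : convCone X} {ξ : StrongDual ℝ X} {c : ℝ} (h : affineFn ξ c ≤ f)
    {x : X} (hx : ((ξ x + c : ℝ) : EReal) < (f : X → EReal) x) :
    ∃ (ξ' : StrongDual ℝ X) (c' : ℝ), affineFn ξ' c' ≤ f ∧ ξ x + c < ξ' x + c' := by
  obtain ⟨t, ht, htf⟩ := EReal.lt_iff_exists_real_btwn.1 hx
  rw [EReal.coe_lt_coe_iff] at ht
  obtain ⟨η, s, u, hxu, hu⟩ := exists_separation f htf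
  have hs : 0 ≤ s := by
    -- otherwise a large `r` violates the separation above a point of the domain
    by_contra! hs
    obtain ⟨y, r, hr⟩ := exists_coe_eq f
    have := hu y (max r ((u - η y) / s)) (by rw [hr, EReal.coe_le_coe_iff]; exact le_max_left _ _)
    have h2 : s * max r ((u - η y) / s) ≤ s * ((u - η y) / s) :=
      mul_le_mul_of_nonpos_left (le_max_right _ _) hs.le
    rw [mul_div_cancel₀ _ hs.ne] at h2
    linarith
  rcases hs.eq_or_lt with rfl | hs
  · -- a vertical hyperplane: tilt the given minorant by it
    refine ⟨ξ - η, c + u, affineFn_le_iff.2 fun y r hr => ?_, ?_⟩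
    · have h1 := affineFn_le_iff.1 h y r hr
      have h2 := hu y r hr
      simp only [sub_apply]
      linarith
    · simp only [sub_apply]
      linarith
  · obtain ⟨ξ', c', h', hc'⟩ := exists_affineFn_le_of_separation hs hxu hu
    exact ⟨ξ', c', h', ht.trans hc'⟩

/-! ### Order-theoretic characterizations -/

theorem isChain_Iic_affineFn (ξ : StrongDual ℝ X) (c : ℝ) :
    ∀ g₁ ≤ affineFn ξ c, ∀ g₂ ≤ affineFn ξ c, g₁ ≤ g₂ ∨ g₂ ≤ g₁ := by
  intro g₁ h₁ g₂ h₂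
  obtain ⟨d₁, rfl⟩ := exists_eq_affineFn_of_le h₁
  obtain ⟨d₂, rfl⟩ := exists_eq_affineFn_of_le h₂
  simpa only [affineFn_le_affineFn_iff, true_and] using le_total d₁ d₂

theorem exists_eq_affineFn_of_isChain_Iic {f : convCone X}
    (h : ∀ g₁ ≤ f, ∀ g₂ ≤ f, g₁ ≤ g₂ ∨ g₂ ≤ g₁) : ∃ ξ c, f = affineFn ξ c := by
  obtain ⟨ξ, c₀, h₀⟩ := exists_affineFn_le f
  have hslope : ∀ ξ' c', affineFn ξ' c' ≤ f → ξ' = ξ := fun ξ' c' h' => by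
    rcases h _ h' _ h₀ with h | h
    · exact (affineFn_le_affineFn_iff.1 h).1
    · exact (affineFn_le_affineFn_iff.1 h).1.symm
  -- the largest constant for which the affine function of slope `ξ` is a minorant
  set S : Set ℝ := {c | affineFn ξ c ≤ f} with hS
  obtain ⟨x₀, r₀, hr₀⟩ := exists_coe_eq f
  have hbdd : BddAbove S := ⟨r₀ - ξ x₀, fun c hc => by
    linarith [affineFn_le_iff.1 hc x₀ r₀ hr₀.le]⟩
  have hmem : affineFn ξ (sSup S) ≤ f := affineFn_le_iff.2 fun y r hr => by
    have : sSup S ≤ r - ξ y := csSup_le ⟨c₀, h₀⟩ fun c hc => by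
      linarith [affineFn_le_iff.1 hc y r hr]
    linarith
  refine ⟨ξ, sSup S, le_antisymm (fun x => ?_) hmem⟩
  by_contra hlt
  obtain ⟨ξ', c', h', hc'⟩ := exists_affineFn_gt hmem (not_le.1 hlt)
  obtain rfl := hslope ξ' c' h'
  have := le_csSup hbdd (show c' ∈ S from h')
  linarith

theorem isChain_Ici_pointFn (x : X) (c : ℝ) :
    ∀ g₁ ≥ pointFn x c, ∀ g₂ ≥ pointFn x c, g₁ ≤ g₂ ∨ g₂ ≤ g₁ := by
  have key : ∀ g ≥ pointFn x c, ∃ d, g = pointFn x d := by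
    intro g hg
    have htop : ∀ y, y ≠ x → (g : X → EReal) y = ⊤ := fun y hy =>
      top_le_iff.1 ((pointFn_apply_of_ne hy c).symm.trans_le (hg y))
    obtain ⟨y, r, hr⟩ := exists_coe_eq g
    have hy : y = x := by
      by_contra hy
      rw [htop y hy] at hr
      exact EReal.top_ne_coe r hr
    subst hy
    refine ⟨r, Subtype.ext (funext fun z => ?_)⟩
    by_cases hz : z = y
    · rw [hz, pointFn_apply_self, hr]
    · rw [pointFn_apply_of_ne hz, htop z hz]
  intro g₁ h₁ g₂ h₂
  obtain ⟨d₁, rfl⟩ := key g₁ h₁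
  obtain ⟨d₂, rfl⟩ := key g₂ h₂
  simpa only [pointFn_le_pointFn_iff, true_and] using le_total d₁ d₂

theorem exists_eq_pointFn_of_isChain_Ici {f : convCone X}
    (h : ∀ g₁ ≥ f, ∀ g₂ ≥ f, g₁ ≤ g₂ ∨ g₂ ≤ g₁) : ∃ x c, f = pointFn x c := by
  obtain ⟨x, r, hr⟩ := exists_coe_eq f
  have hx : f ≤ pointFn x r := le_pointFn_iff.2 hr.le
  refine ⟨x, r, le_antisymm hx fun y => ?_⟩
  by_cases hy : y = x
  · rw [hy, pointFn_apply_self, hr]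
  · rw [pointFn_apply_of_ne hy, EReal.le_iff_forall_real]
    intro s hs
    exfalso
    rcases h _ hx _ (le_pointFn_iff.2 hs) with h | h
    · exact hy (pointFn_le_pointFn_iff.1 h).1.symm
    · exact hy (pointFn_le_pointFn_iff.1 h).1

/-! ### A functional equation for slopes and base points -/

/-- A decreasing surjection of `ℝ` whose increments do not depend on the base point is affine. -/
theorem exists_eq_sub_mul_of_antitone {b : ℝ → ℝ} (hb : Antitone b) (hs : Function.Surjective b)
    (h : ∀ t c, b c - b (c + t) = b 0 - b t) : ∃ α, 0 < α ∧ ∀ c, b c = b 0 - α * c := by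
  let g : ℝ →+ ℝ :=
    { toFun := fun t => b 0 - b t
      map_zero' := sub_self _
      map_add' := fun s t => by linarith [h t s] }
  have hgm : Monotone g := fun s t hst => sub_le_sub_left (hb hst) _
  have hgs : Function.Surjective g := fun r => by
    obtain ⟨t, ht⟩ := hs (b 0 - r)
    exact ⟨t, by change b 0 - b t = r; rw [ht]; ring⟩
  have hlin : ∀ c, b 0 - b c = c * (b 0 - b 1) := fun c => by
    have := map_real_smul g (hgm.continuous_of_surjective hgs) c 1
    rwa [smul_eq_mul, mul_one, smul_eq_mul] at this
  refine ⟨b 0 - b 1, lt_of_le_of_ne (sub_nonneg.2 (hb zero_le_one)) fun h0 => ?_, fun c => ?_⟩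
  · obtain ⟨c, hc⟩ := hs (b 0 - 1)
    have := hlin c
    rw [← h0, hc] at this
    linarith
  · linarith [hlin c]

/-- If a map `q` onto the dual and a map `z` from the dual onto `X` are adjoint up to the factor
`α`, then `z` is a linear homeomorphism. Each of the two maps being onto forces linearity of the
other one; continuity comes from the closed graph theorem. -/
theorem exists_continuousLinearEquiv_of_pairing [CompleteSpace X] {q : X → StrongDual ℝ X}
    {z : StrongDual ℝ X → X} {α : ℝ} (hα : 0 < α) (hq : Function.Surjective q)
    (hz : Function.Surjective z) (h : ∀ x ξ, q x (z ξ) = α * ξ x) :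
    ∃ U : X ≃L[ℝ] StrongDual ℝ X, ∀ ξ, U (z ξ) = ξ := by
  have hext : ∀ v w : X, (∀ x, q x v = q x w) → v = w := fun v w hvw => by
    refine (SeparatingDual.eq_iff_forall_dual_eq (R := ℝ)).2 fun η => ?_
    obtain ⟨x, rfl⟩ := hq η
    exact hvw x
  let Z : StrongDual ℝ X →ₗ[ℝ] X :=
    { toFun := z
      map_add' := fun ξ η => hext _ _ fun x => by
        rw [map_add, h, h, h, add_apply]; ring
      map_smul' := fun c ξ => hext _ _ fun x => by
        rw [map_smul, h, h, smul_apply]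
        simp only [smul_eq_mul, RingHom.id_apply]; ring }
  have hinj : Function.Injective Z := fun ξ η hξη => by
    ext x
    have h1 := h x ξ
    rw [show z ξ = z η from hξη, h] at h1
    exact (mul_left_cancel₀ hα.ne' h1).symm
  let e : X ≃ₗ[ℝ] StrongDual ℝ X := (LinearEquiv.ofBijective Z ⟨hinj, hz⟩).symm
  have he : ∀ ξ, e (z ξ) = ξ := fun ξ => (LinearEquiv.ofBijective Z ⟨hinj, hz⟩).symm_apply_apply ξ
  have hqe : ∀ x v, q x v = α * e v x := fun x v => by
    obtain ⟨ξ, rfl⟩ := hz v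
    rw [h, he]
  have hcont : Continuous e := by
    refine LinearMap.continuous_of_seq_closed_graph (g := e.toLinearMap) fun u v η hu hη => ?_
    ext x
    have h1 : Tendsto (fun n => α * e (u n) x) atTop (𝓝 (α * e v x)) := by
      simp only [← hqe]
      exact ((q x).continuous.tendsto v).comp hu
    have h2 : Tendsto (fun n => α * e (u n) x) atTop (𝓝 (α * η x)) :=
      (((ContinuousLinearMap.apply ℝ ℝ x).continuous.tendsto η).comp hη).const_mul α
    exact mul_left_cancel₀ hα.ne' (tendsto_nhds_unique h2 h1)
  exact ⟨e.toContinuousLinearEquivOfContinuous hcont, he⟩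

/-- The functional equation relating the images `affineFn (p x) (β x c)` of point functions and the
images `pointFn (y ξ) (γ ξ c)` of affine functions, and its solution. -/
theorem exists_equiv_of_functional_equation [CompleteSpace X] [Nontrivial X]
    {p : X → StrongDual ℝ X} {y : StrongDual ℝ X → X} {β : X → ℝ → ℝ} {γ : StrongDual ℝ X → ℝ → ℝ}
    (hp : Function.Surjective p) (hy : Function.Surjective y) (hβ : Antitone (β 0))
    (hβs : Function.Surjective (β 0)) (h : ∀ x ξ c, γ ξ c = p x (y ξ) + β x (ξ x + c)) :
    ∃ (U : X ≃L[ℝ] StrongDual ℝ X) (α : ℝ), 0 < α ∧ (∀ ξ, U (y ξ - y 0) = ξ) ∧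
      ∀ ξ c, γ ξ c = p 0 (y ξ) + β 0 0 - α * c := by
  have h₀ : ∀ ξ c, γ ξ c = p 0 (y ξ) + β 0 c := fun ξ c => by simpa using h 0 ξ c
  have hinc : ∀ x ξ c, β 0 c - β 0 (c + ξ x) = (p x - p 0) (y ξ - y 0) := fun x ξ c => by
    have h1 := h x ξ c
    have h2 := h x 0 (ξ x + c)
    rw [h₀] at h1 h2
    simp only [zero_apply, zero_add] at h2
    rw [sub_apply, map_sub, map_sub, add_comm c]
    linarith
  obtain ⟨x₁, hx₁⟩ := exists_ne (0 : X)
  obtain ⟨ξ₁, hξ₁⟩ := SeparatingDual.exists_eq_one (R := ℝ) hx₁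
  obtain ⟨α, hα, hlin⟩ := exists_eq_sub_mul_of_antitone hβ hβs fun t c => by
    -- every real `t` is the value at `x₁` of some functional
    have e : (t • ξ₁) x₁ = t := by simp [hξ₁]
    have h1 := hinc x₁ (t • ξ₁) c
    have h2 := hinc x₁ (t • ξ₁) 0
    rw [e] at h1 h2
    rw [h1, ← h2, zero_add]
  obtain ⟨U, hU⟩ := exists_continuousLinearEquiv_of_pairing (q := fun x => p x - p 0)
    (z := fun ξ => y ξ - y 0) hα
    (fun η => by obtain ⟨x, hx⟩ := hp (η + p 0); exact ⟨x, by simp [hx]⟩)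
    (fun v => by obtain ⟨ξ, hξ⟩ := hy (v + y 0); exact ⟨ξ, by simp [hξ]⟩)
    (fun x ξ => by
      rw [← hinc x ξ 0, hlin (0 + ξ x)]; ring)
  exact ⟨U, α, hα, hU, fun ξ c => by rw [h₀, hlin c]; ring⟩

/-! ### The action of an order reversing map on affine and point functions -/

namespace IsFullyOrderReversing

variable {T : convCone X → convCone X}

theorem map_pointFn (hT : IsFullyOrderReversing T) (x : X) (c : ℝ) :
    ∃ ξ d, T (pointFn x c) = affineFn ξ d := by
  refine exists_eq_affineFn_of_isChain_Iic fun g₁ h₁ g₂ h₂ => ?_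
  obtain ⟨f₁, rfl⟩ := hT.1.2 g₁
  obtain ⟨f₂, rfl⟩ := hT.1.2 g₂
  rw [← hT.2, ← hT.2]
  exact (isChain_Ici_pointFn x c f₁ ((hT.2 _ _).2 h₁) f₂ ((hT.2 _ _).2 h₂)).symm

theorem map_affineFn (hT : IsFullyOrderReversing T) (ξ : StrongDual ℝ X) (c : ℝ) :
    ∃ x d, T (affineFn ξ c) = pointFn x d := by
  refine exists_eq_pointFn_of_isChain_Ici fun g₁ h₁ g₂ h₂ => ?_
  obtain ⟨f₁, rfl⟩ := hT.1.2 g₁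
  obtain ⟨f₂, rfl⟩ := hT.1.2 g₂
  rw [← hT.2, ← hT.2]
  exact (isChain_Iic_affineFn ξ c f₁ ((hT.2 _ _).2 h₁) f₂ ((hT.2 _ _).2 h₂)).symm

theorem exists_pointFn_of_map_eq_affineFn (hT : IsFullyOrderReversing T) (η : StrongDual ℝ X)
    (e : ℝ) : ∃ x c, T (pointFn x c) = affineFn η e := by
  obtain ⟨f, hf⟩ := hT.1.2 (affineFn η e)
  obtain ⟨x, c, rfl⟩ := exists_eq_pointFn_of_isChain_Ici (f := f) fun g₁ h₁ g₂ h₂ => by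
    exact (isChain_Iic_affineFn η e _ (hf ▸ (hT.2 _ _).1 h₁) _ (hf ▸ (hT.2 _ _).1 h₂)).symm.imp
      (hT.2 _ _).2 (hT.2 _ _).2
  exact ⟨x, c, hf⟩

theorem exists_affineFn_of_map_eq_pointFn (hT : IsFullyOrderReversing T) (v : X)
    (e : ℝ) : ∃ ξ c, T (affineFn ξ c) = pointFn v e := by
  obtain ⟨f, hf⟩ := hT.1.2 (pointFn v e)
  obtain ⟨ξ, c, rfl⟩ := exists_eq_affineFn_of_isChain_Iic (f := f) fun g₁ h₁ g₂ h₂ => by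
    exact (isChain_Ici_pointFn v e _ (hf ▸ (hT.2 _ _).1 h₁) _ (hf ▸ (hT.2 _ _).1 h₂)).symm.imp
      (hT.2 _ _).2 (hT.2 _ _).2
  exact ⟨ξ, c, hf⟩

/-- The image of `pointFn x c` has a slope depending on `x` only, and a constant term that is a
decreasing bijective function of `c`. -/
theorem exists_slope (hT : IsFullyOrderReversing T) :
    ∃ (p : X → StrongDual ℝ X) (β : X → ℝ → ℝ), Function.Surjective p ∧
      (∀ x, Antitone (β x)) ∧ (∀ x, Function.Surjective (β x)) ∧
      ∀ x c, T (pointFn x c) = affineFn (p x) (β x c) := by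
  choose P β hPβ using hT.map_pointFn
  have hle : ∀ x y c d, (x = y ∧ c ≤ d) ↔ (P y d = P x c ∧ β y d ≤ β x c) := fun x y c d => by
    rw [← pointFn_le_pointFn_iff, ← affineFn_le_affineFn_iff, ← hPβ, ← hPβ, ← hT.2]
  have hP : ∀ x c, P x c = P x 0 := fun x c => by
    rcases le_total c 0 with h | h
    · exact ((hle x x c 0).1 ⟨rfl, h⟩).1.symm
    · exact ((hle x x 0 c).1 ⟨rfl, h⟩).1
  refine ⟨fun x => P x 0, β, fun η => ?_, fun x c d hcd => ((hle x x c d).1 ⟨rfl, hcd⟩).2,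
    fun x e => ?_, fun x c => by rw [hPβ, hP]⟩
  · obtain ⟨x, c, hx⟩ := hT.exists_pointFn_of_map_eq_affineFn η 0
    rw [hPβ, hP] at hx
    exact ⟨x, (affineFn_inj hx).1⟩
  · obtain ⟨x', c, hx⟩ := hT.exists_pointFn_of_map_eq_affineFn (P x 0) e
    rw [hPβ] at hx
    obtain ⟨h1, h2⟩ := affineFn_inj hx
    obtain rfl : x' = x := by
      rcases le_total (β x 0) (β x' c) with h | h
      · exact ((hle x' x c 0).2 ⟨h1.symm, h⟩).1
      · exact ((hle x x' 0 c).2 ⟨h1, h⟩).1.symm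
    exact ⟨c, h2⟩

/-- The image of `affineFn ξ c` is supported at a point depending on `ξ` only. -/
theorem exists_base (hT : IsFullyOrderReversing T) :
    ∃ (y : StrongDual ℝ X → X) (γ : StrongDual ℝ X → ℝ → ℝ), Function.Surjective y ∧
      ∀ ξ c, T (affineFn ξ c) = pointFn (y ξ) (γ ξ c) := by
  choose Y γ hYγ using hT.map_affineFn
  have hY : ∀ ξ c, Y ξ c = Y ξ 0 := fun ξ c => by
    have key : ∀ c d, c ≤ d → Y ξ d = Y ξ c := fun c d hcd => by
      have h := (hT.2 (affineFn ξ d) (affineFn ξ c)).1 (affineFn_le_affineFn_iff.2 ⟨rfl, hcd⟩)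
      rw [hYγ, hYγ] at h
      exact (pointFn_le_pointFn_iff.1 h).1
    rcases le_total c 0 with h | h
    · exact (key c 0 h).symm
    · exact key 0 c h
  refine ⟨fun ξ => Y ξ 0, γ, fun v => ?_, fun ξ c => by rw [hYγ, hY]⟩
  obtain ⟨ξ, c, hξ⟩ := hT.exists_affineFn_of_map_eq_pointFn v 0
  rw [hYγ, hY] at hξ
  exact ⟨ξ, (pointFn_inj hξ).1⟩

/-- Comparing `affineFn ξ c` with the point functions at `x` before and after applying `T`. -/
theorem functional_equation (hT : IsFullyOrderReversing T) {p : X → StrongDual ℝ X}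
    {y : StrongDual ℝ X → X} {β : X → ℝ → ℝ} {γ : StrongDual ℝ X → ℝ → ℝ}
    (hβ : ∀ x, Antitone (β x)) (hβs : ∀ x, Function.Surjective (β x))
    (hp : ∀ x c, T (pointFn x c) = affineFn (p x) (β x c))
    (hy : ∀ ξ c, T (affineFn ξ c) = pointFn (y ξ) (γ ξ c)) (x : X) (ξ : StrongDual ℝ X) (c : ℝ) :
    γ ξ c = p x (y ξ) + β x (ξ x + c) := by
  have key : ∀ d, ξ x + c ≤ d ↔ p x (y ξ) + β x d ≤ γ ξ c := fun d => by
    rw [← affineFn_le_pointFn_iff, ← affineFn_le_pointFn_iff, ← hp, ← hy, ← hT.2]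
  refine le_antisymm ?_ ((key _).1 le_rfl)
  obtain ⟨d, hd⟩ := hβs x (γ ξ c - p x (y ξ))
  have h1 : ξ x + c ≤ d := (key d).2 (by linarith)
  linarith [hβ x h1]

end IsFullyOrderReversing

end

theorem theorem7p6 {X : Type*} [NormedAddCommGroup X] [NormedSpace ℝ X] [CompleteSpace X]
    [Nontrivial X] (T : convCone X → convCone X) (hT : IsFullyOrderReversing T) :
    ∃ (U : X ≃L[ℝ] StrongDual ℝ X) (x₀ φ : StrongDual ℝ X) (α r₀ : ℝ), 0 < α ∧
      ∀ (f : convCone X) (x : X),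
        (T f : X → EReal) x =
          (α : EReal) * fenchelTransform (f : X → EReal) (U x + x₀)
            + ((φ x : ℝ) : EReal) + (r₀ : EReal) := by
  obtain ⟨p, β, hps, hβ, hβs, hp⟩ := hT.exists_slope
  obtain ⟨y, γ, hys, hy⟩ := hT.exists_base
  obtain ⟨U, α, hα, hU, hγ⟩ := exists_equiv_of_functional_equation hps hys (hβ 0) (hβs 0)
    (hT.functional_equation hβ hβs hp hy)
  refine ⟨U, -U (y 0), p 0, α, β 0 0, hα, fun f x => ?_⟩
  obtain ⟨ξ, rfl⟩ := hys x
  have hξ : U (y ξ) + -U (y 0) = ξ := by rw [← sub_eq_add_neg, ← map_sub, hU]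
  rw [hξ]
  -- both sides lie below the same real numbers
  have key : ∀ e : ℝ, (T f : X → EReal) (y ξ) ≤ e ↔
      (α : EReal) * fenchelTransform (f : X → EReal) ξ + ((p 0 (y ξ) : ℝ) : EReal)
        + ((β 0 0 : ℝ) : EReal) ≤ e := fun e => by
    have he : e = γ ξ ((p 0 (y ξ) + β 0 0 - e) / α) := by
      rw [hγ, mul_div_cancel₀ _ hα.ne']; ring
    rw [← le_pointFn_iff, he, ← hy, ← hT.2, ge_iff_le, affineFn_le_iff_fenchelTransform_le, ← he]
    have hα' : (0 : EReal) < α := by exact_mod_cast hα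
    induction fenchelTransform (f : X → EReal) ξ with
    | bot => simp [EReal.coe_mul_bot_of_pos hα]
    | top => simp [EReal.coe_mul_top_of_pos hα]
    | coe r =>
      rw [← EReal.coe_mul, ← EReal.coe_add, ← EReal.coe_add, EReal.coe_le_coe_iff,
        EReal.coe_le_coe_iff, ← neg_div, le_div_iff₀ hα]
      constructor <;> intro h <;> linarith
  exact le_antisymm (EReal.le_iff_forall_real.2 fun e => (key e).2)
    (EReal.le_iff_forall_real.2 fun e => (key e).1)
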